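/- **Conventions.** Let FI be the category whose objects are the sets $[n]=\{1,\dots,n\}$, $n\ge 0$, and whose morphisms are the injections. An FI-module over a commutative ring $k$ is a functor $V$ from FI to $k$-modules, and $V_n=V([n])$. It is *finitely generated in degree $\le d$* if some finite subset of $\bigoplus_{n=0}^{d}V_n$ is contained in no proper submodule of $V$, *finitely generated* if this holds for some $d$, and *$d$-small* if it is a subquotient of an FI-module that is finitely generated in degree $\le d$. A partition $\lambda$ of an integer $|\lambda|=m\ge 0$ is *primitive* if no part of $\lambda$ equals $1$. For $n\ge m$ let $c^n_\lambda\subseteq \mathfrak S_n$ be the conjugacy class of permutations of cycle type $(\lambda,1,\dots,1)$ (with $n-m$ added ones), and put $c^n_\lambda=\emptyset$ for $n<m$. For a finite set $\boldsymbol\lambda$ of primitive partitions let $|\boldsymbol\lambda|=\max_{\lambda\in\boldsymbol\lambda}|\lambda|$ (with $|\emptyset|=0$), and let $c^n_{\boldsymbol\lambda}=\bigcup_{\lambda\in\boldsymbol\lambda}c^n_\lambda$, a quandle under $x\rhd y=yxy^{-1}$. An injection $f:[m]\to[n]$ induces a quandle homomorphism $f_*:c^m_{\boldsymbol\lambda}\to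 c^n_{\boldsymbol\lambda}$, where $f_*(\sigma)$ is $f\circ\sigma\circ f^{-1}$ on the image of $f$ and the identity outside of it. For a rack $X$, let $C^R_0(X;k)=0$ and, for $i\ge1$, let $C^R_i(X;k)$ be the free $k$-module on $X^i$, with differential $\partial_1=0$ and, for $i\ge2$, $$\partial_i(x_1,\dots,x_i)=\sum_{j=2}^{i}(-1)^j\bigl((x_1,\dots,x_{j-1},x_{j+1},\dots,x_i)-(x_1\rhd x_j,\dots,x_{j-1}\rhd x_j,x_{j+1},\dots,x_i)\bigr).$$ If $X$ is a quandle, let $C^Q_\bullet(X;k)$ be the quotient of $C^R_\bullet(X;k)$ by the subcomplex spanned by the tuples with $x_j=x_{j+1}$ for some $j$. Write $H^R_i(X;k)$ and $H^Q_i(X;k)$ for the $i$-th homology of these complexes (rack and quandle homology). Applying $f_*$ to every entry of a tuple makes $n\mapsto H^R_i(c^n_{\boldsymbol\lambda};k)$ and $n\mapsto H^Q_i(c^n_{\boldsymbol\lambda};k)$ into FI-modules $H^R_i(c^\bullet_{\boldsymbol\lambda};k)$ and $H^Q_i(c^\bullet_{\boldsymbol\lambda};k)$. **Theorem.** Let $\boldsymbol\lambda$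 be a finite set of primitive partitions, let $i\ge 0$ be an integer, and let $k$ be a commutative Noetherian ring. Then the FI-modules $H^R_i(c^\bullet_{\boldsymbol\lambda};k)$ and $H^Q_i(c^\bullet_{\boldsymbol\lambda};k)$ are finitely generated. Moreover, both are $(i\cdot|\boldsymbol\lambda|)$-small. -/

import Mathlib

open CategoryTheory
open scoped Quandles

universe u v w

/-! ## The rack complex and the quandle complex

A rack in the right-handed convention `(x ▷ y) ▷ z = (x ▷ z) ▷ (y ▷ z)`, with all maps `· ▷ x`
bijective, is the same thing as a `Rack` with `x ▷ y = y ◃ x`.  So `x l ▷ x j` is written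
`x j ◃ x l` below. -/

namespace RackHomology

section Complex

variable (X : Type v) (k : Type u) [CommRing k]

/-- The basis of the rack chains in degree `i`: all `i`-tuples if `i ≥ 1`, and the empty set
if `i = 0` (by convention, the chains in degree `0` vanish). -/
def Cell : ℕ → Type v
  | 0 => PEmpty
  | n + 1 => Fin (n + 1) → X

/-- The rack chains of degree `i` with coefficients in `k`. -/
abbrev Chain (i : ℕ) : Type (max u v) := Cell X i →₀ k

variable {X}

/-- `(x₁, …, x_{j-1}, x_{j+1}, …)` -/
def del {n : ℕ} (j : Fin (n + 1)) (x : Fin (n + 1) → X) : Fin n → X :=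
  fun l => x (j.succAbove l)

lemma succAbove_comm {n : ℕ} {i j : Fin (n + 1)} (h : i ≤ j) (l : Fin n) :
    j.succ.succAbove (i.succAbove l) = i.castSucc.succAbove (j.succAbove l) := by
  simp only [Fin.succAbove, Fin.lt_def, Fin.ext_iff, Fin.le_def] at *
  grind [Fin.val_castSucc]

lemma del_del {n : ℕ} {i j : Fin (n + 1)} (h : i ≤ j) (x : Fin (n + 2) → X) :
    del i (del j.succ x) = del j (del i.castSucc x) := by
  funext l
  simp only [del, succAbove_comm h]

lemma succAbove_succ_self {n : ℕ} {i j : Fin (n + 1)} (h : i ≤ j) :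
    j.succ.succAbove i = i.castSucc := by
  simp only [Fin.succAbove, Fin.lt_def, Fin.ext_iff, Fin.le_def] at *
  grind [Fin.val_castSucc]

lemma succAbove_castSucc_self {n : ℕ} {i j : Fin (n + 1)} (h : i ≤ j) :
    i.castSucc.succAbove j = j.succ := by
  simp only [Fin.succAbove, Fin.lt_def, Fin.ext_iff, Fin.le_def] at *
  grind [Fin.val_castSucc]

lemma succAbove_lt_iff {n : ℕ} {i j : Fin (n + 1)} (h : i ≤ j) (l : Fin n) :
    i.castSucc.succAbove (j.succAbove l) < j.succ ↔ j.succAbove l < j := by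
  simp only [Fin.succAbove, Fin.lt_def, Fin.ext_iff, Fin.le_def] at *
  grind [Fin.val_castSucc]

lemma succAbove_lt_iff' {n : ℕ} {i j : Fin (n + 1)} (h : i ≤ j) (l : Fin n) :
    i.castSucc.succAbove (j.succAbove l) < i.castSucc ↔ i.succAbove l < i := by
  simp only [Fin.succAbove, Fin.lt_def, Fin.ext_iff, Fin.le_def] at *
  grind [Fin.val_castSucc]

lemma succAbove_lt_of_lt {n : ℕ} {i j : Fin (n + 1)} (h : i ≤ j) (l : Fin n)
    (hl : i.succAbove l < i) : j.succAbove l < j := by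
  simp only [Fin.succAbove, Fin.lt_def, Fin.ext_iff, Fin.le_def] at *
  grind [Fin.val_castSucc]

lemma castSucc_lt_succ' {n : ℕ} {i j : Fin (n + 1)} (h : i ≤ j) :
    i.castSucc < j.succ := by
  simp only [Fin.lt_def, Fin.le_def, Fin.val_castSucc, Fin.val_succ] at *
  omega

variable [Rack X]

/-- `(x₁ ▷ x_j, …, x_{j-1} ▷ x_j, x_{j+1}, …)` -/
def actDel {n : ℕ} (j : Fin (n + 1)) (x : Fin (n + 1) → X) : Fin n → X :=
  fun l => if j.succAbove l < j then x j ◃ x (j.succAbove l) else x (j.succAbove l)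

/-- The linear map given on a tuple `x` by `del j x - actDel j x`. -/
noncomputable def face {n : ℕ} (j : Fin (n + 1)) :
    ((Fin (n + 1) → X) →₀ k) →ₗ[k] ((Fin n → X) →₀ k) :=
  Finsupp.lmapDomain k k (del j) - Finsupp.lmapDomain k k (actDel j)

/-- The linear map given on a tuple of length `n + 1` by
`(x₁, …, x_{n+1}) ↦ ∑_{j = 2}^{n + 1} (-1)^j ((x₁, …, x_{j-1}, x_{j+1}, …, x_{n+1})
  - (x₁ ▷ x_j, …, x_{j-1} ▷ x_j, x_{j+1}, …, x_{n+1}))`.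
Here the entries of a tuple are counted from `1`; as they are counted from `0` in the code, the
summation index `j : Fin n` of the code stands for the position `j + 2`. -/
noncomputable def tupleBoundary (n : ℕ) : ((Fin (n + 1) → X) →₀ k) →ₗ[k] ((Fin n → X) →₀ k) :=
  ∑ j : Fin n, (-1 : k) ^ ((j : ℕ) + 2) • face k j.succ

variable (X)

/-- The differential of the rack complex from degree `i + 1` to degree `i`. -/
noncomputable def boundary : (i : ℕ) → Chain X k (i + 1) →ₗ[k] Chain X k i
  | 0 => 0
  | n + 1 => tupleBoundary k (n + 1)

variable {X}

lemma face_single {n : ℕ} (j : Fin (n + 1)) (x : Fin (n + 1) → X) (a : k) :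
    face k j (Finsupp.single x a) =
      Finsupp.single (del j x) a - Finsupp.single (actDel j x) a := by
  simp [face]

lemma face_zero {n : ℕ} : face k (X := X) (0 : Fin (n + 1)) = 0 := by
  have : (actDel (0 : Fin (n + 1)) : (Fin (n + 1) → X) → _) = del 0 := by
    funext x l; simp [actDel, del]
  refine Finsupp.lhom_ext fun x a => ?_
  rw [face_single, this, sub_self, LinearMap.zero_apply]

lemma tupleBoundary_eq (n : ℕ) :
    tupleBoundary k n = ∑ j : Fin (n + 1), (-1 : k) ^ ((j : ℕ) + 1) • face k (X := X) j := by
  rw [Fin.sum_univ_succ, face_zero, smul_zero, zero_add]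
  rfl

lemma del_actDel {n : ℕ} {i j : Fin (n + 1)} (h : i ≤ j) (x : Fin (n + 2) → X) :
    del i (actDel j.succ x) = actDel j (del i.castSucc x) := by
  funext l
  simp only [del, actDel, succAbove_comm h, succAbove_lt_iff h, succAbove_castSucc_self h]

lemma actDel_del {n : ℕ} {i j : Fin (n + 1)} (h : i ≤ j) (x : Fin (n + 2) → X) :
    actDel i (del j.succ x) = del j (actDel i.castSucc x) := by
  funext l
  simp only [del, actDel, succAbove_comm h, succAbove_lt_iff' h, succAbove_succ_self h]

lemma actDel_actDel {n : ℕ} {i j : Fin (n + 1)} (h : i ≤ j) (x : Fin (n + 2) → X) :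
    actDel i (actDel j.succ x) = actDel j (actDel i.castSucc x) := by
  funext l
  simp only [actDel, succAbove_comm h, succAbove_lt_iff' h, succAbove_succ_self h,
    succAbove_lt_iff h, succAbove_castSucc_self h, castSucc_lt_succ' h, if_true,
    if_neg (castSucc_lt_succ' h).asymm]
  by_cases h1 : i.succAbove l < i
  · simp only [h1, succAbove_lt_of_lt h l h1, if_true]
    exact Shelf.self_distrib.symm
  · simp only [h1, if_false]

lemma face_face {n : ℕ} {i j : Fin (n + 1)} (h : i ≤ j) :
    face k (X := X) i ∘ₗ face k j.succ = face k j ∘ₗ face k i.castSucc := by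
  refine Finsupp.lhom_ext fun x a => ?_
  simp only [LinearMap.comp_apply, face_single, map_sub, del_del h, del_actDel h, actDel_del h,
    actDel_actDel h]
  abel

lemma tupleBoundary_tupleBoundary (n : ℕ) :
    tupleBoundary k n ∘ₗ tupleBoundary k (X := X) (n + 1) = 0 := by
  refine LinearMap.ext fun c => ?_
  have e : tupleBoundary k n (tupleBoundary k (n + 1) c) =
      ∑ a : Fin (n + 1), ∑ b : Fin (n + 2),
        (-1 : k) ^ ((a : ℕ) + (b : ℕ)) • face k a (face k b c) := by
    simp only [tupleBoundary_eq, LinearMap.sum_apply, map_sum, LinearMap.smul_apply, map_smul,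
      Finset.smul_sum, smul_smul]
    rw [Finset.sum_comm]
    refine Finset.sum_congr rfl fun a _ => Finset.sum_congr rfl fun b _ => ?_
    congr 1
    ring
  rw [LinearMap.comp_apply, LinearMap.zero_apply, e, ← Finset.sum_product']
  let P := Fin (n + 1) × Fin (n + 2)
  let S : Finset P := {ij : P | (ij.2 : ℕ) ≤ (ij.1 : ℕ)}
  rw [Finset.univ_product_univ, ← Finset.sum_add_sum_compl S, ← eq_neg_iff_add_eq_zero,
    ← Finset.sum_neg_distrib]
  let φ : ∀ ij : P, ij ∈ S → P := fun ij hij =>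
    (Fin.castLT ij.2 (lt_of_le_of_lt (Finset.mem_filter.mp hij).right (Fin.is_lt ij.1)), ij.1.succ)
  apply Finset.sum_bij φ
  · intro ij hij
    simp_rw [S, φ, Finset.compl_filter, Finset.mem_filter_univ, Fin.val_succ,
      Fin.val_castLT] at hij ⊢
    lia
  · rintro ⟨i, j⟩ hij ⟨i', j'⟩ hij' h
    rw [Prod.mk_inj]
    exact ⟨by simpa [φ] using! congr_arg Prod.snd h,
      by simpa [φ, Fin.castSucc_castLT] using! congr_arg Fin.castSucc (congr_arg Prod.fst h)⟩
  · rintro ⟨i', j'⟩ hij'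
    simp_rw [S, Finset.compl_filter, Finset.mem_filter_univ, not_le] at hij'
    refine ⟨(j'.pred <| ?_, Fin.castSucc i'), ?_, ?_⟩
    · rintro rfl
      simp only [Fin.val_zero, not_lt_zero] at hij'
    · simpa [S] using! Nat.le_sub_one_of_lt hij'
    · simp only [φ, Fin.castLT_castSucc, Fin.succ_pred]
  · rintro ⟨i, j⟩ hij
    have hij' : (j : ℕ) ≤ i := (Finset.mem_filter.mp hij).right
    obtain ⟨j, rfl⟩ : ∃ j' : Fin (n + 1), j = j'.castSucc :=
      ⟨j.castLT (lt_of_le_of_lt hij' i.is_lt), by simp⟩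
    have h : j ≤ i := hij'
    simp only [φ, Fin.castLT_castSucc]
    have hf := LinearMap.congr_fun (face_face k h) c
    rw [LinearMap.comp_apply, LinearMap.comp_apply] at hf
    rw [hf, ← neg_smul]
    congr 1
    simp only [Fin.val_castSucc, Fin.val_succ]
    ring

lemma boundary_boundary (i : ℕ) : boundary X k i ∘ₗ boundary X k (i + 1) = 0 := by
  obtain _ | n := i
  · exact LinearMap.zero_comp _
  · exact tupleBoundary_tupleBoundary k (n + 1)

variable (X)

/-- The rack complex `C^R(X; k)`. -/
noncomputable def rackComplex : ChainComplex (ModuleCat.{max u v} k) ℕ :=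
  ChainComplex.of (fun i => ModuleCat.of k (Chain X k i))
    (fun i => ModuleCat.ofHom (boundary X k i))
    (fun i => by rw [← ModuleCat.ofHom_comp, boundary_boundary]; rfl)

end Complex

section Quandle

variable (X : Type v) (k : Type u) [CommRing k]

variable {X} in
/-- The span of the tuples `x` with `x_j = x_{j+1}` for some `j`. -/
noncomputable def tupleDegenerate (n : ℕ) : Submodule k ((Fin n → X) →₀ k) :=
  Submodule.span k
    {c | ∃ x : Fin n → X, (∃ l m : Fin n, (m : ℕ) = l + 1 ∧ x l = x m) ∧ c = Finsupp.single x 1}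

/-- The submodule of the rack chains of degree `i` that is spanned by the tuples `x`
with `x_j = x_{j+1}` for some `j`. -/
noncomputable def degenerate : (i : ℕ) → Submodule k (Chain X k i)
  | 0 => ⊥
  | n + 1 => tupleDegenerate k (n + 1)

variable {X}

lemma single_mem_tupleDegenerate {n : ℕ} (x : Fin n → X)
    (h : ∃ l m : Fin n, (m : ℕ) = l + 1 ∧ x l = x m) (a : k) :
    Finsupp.single x a ∈ tupleDegenerate k (X := X) n := by
  have h1 : Finsupp.single x 1 ∈ tupleDegenerate k (X := X) n := Submodule.subset_span ⟨x, h, rfl⟩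
  have h2 := Submodule.smul_mem _ a h1
  rwa [Finsupp.smul_single, smul_eq_mul, mul_one] at h2

variable [Quandle X]

lemma tupleBoundary_mem (n : ℕ) :
    tupleDegenerate k (X := X) (n + 1) ≤ (tupleDegenerate k n).comap (tupleBoundary k n) := by
  refine Submodule.span_le.2 ?_
  rintro _ ⟨x, ⟨l₀, m₀, hlm₀, hj⟩, rfl⟩
  obtain ⟨j, rfl, rfl⟩ : ∃ j : Fin n, l₀ = j.castSucc ∧ m₀ = j.succ :=
    ⟨⟨l₀, by omega⟩, rfl, Fin.ext hlm₀⟩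
  change tupleBoundary k n _ ∈ tupleDegenerate k n
  rw [tupleBoundary_eq, LinearMap.sum_apply]
  -- the terms with indices `j` and `j + 1` cancel, the others are degenerate
  have hne : j.castSucc ≠ j.succ := (Fin.castSucc_lt_succ).ne
  rw [← Finset.add_sum_erase _ _ (Finset.mem_univ j.castSucc),
    ← Finset.add_sum_erase _ _ (Finset.mem_erase.2 ⟨hne.symm, Finset.mem_univ j.succ⟩), ← add_assoc]
  refine Submodule.add_mem _ ?_ (Submodule.sum_mem _ fun p hp => ?_)
  · have h1 : del j.castSucc x = del j.succ x := by
      funext l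
      simp only [del]
      rcases lt_trichotomy (l : ℕ) j with h | h | h
      · congr 1
        simp only [Fin.succAbove, Fin.lt_def, Fin.ext_iff]
        grind [Fin.val_castSucc]
      · obtain rfl : l = j := Fin.ext h
        simp [hj]
      · congr 1
        simp only [Fin.succAbove, Fin.lt_def, Fin.ext_iff]
        grind [Fin.val_castSucc]
    have h2 : actDel j.castSucc x = actDel j.succ x := by
      funext l
      simp only [actDel, ← hj]
      rcases lt_trichotomy (l : ℕ) j with h | h | h
      · have e : j.castSucc.succAbove l = j.succ.succAbove l := by
          simp only [Fin.succAbove, Fin.lt_def, Fin.ext_iff]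
          grind [Fin.val_castSucc]
        have l1 : j.succ.succAbove l < j.castSucc := by
          simp only [Fin.succAbove, Fin.lt_def, Fin.ext_iff]
          grind [Fin.val_castSucc]
        rw [e, if_pos l1, if_pos (l1.trans Fin.castSucc_lt_succ)]
      · obtain rfl : l = j := Fin.ext h
        simp [← hj, Quandle.fix]
      · have e : j.castSucc.succAbove l = j.succ.succAbove l := by
          simp only [Fin.succAbove, Fin.lt_def, Fin.ext_iff]
          grind [Fin.val_castSucc]
        have l1 : ¬ j.succ.succAbove l < j.succ := by
          simp only [Fin.succAbove, Fin.lt_def, Fin.ext_iff]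
          grind [Fin.val_castSucc]
        rw [e, if_neg l1, if_neg fun h' => l1 (h'.trans Fin.castSucc_lt_succ)]
    simp only [LinearMap.smul_apply, face_single, h1, h2, ← add_smul]
    rw [Fin.val_succ, Fin.val_castSucc, pow_succ _ ((j : ℕ) + 1), mul_neg_one, add_neg_cancel,
      zero_smul]
    exact Submodule.zero_mem _
  · rw [LinearMap.smul_apply, face_single]
    simp only [Finset.mem_erase, Finset.mem_univ, and_true] at hp
    obtain ⟨l, m, hlm, hl, hm⟩ : ∃ l m : Fin n, (m : ℕ) = l + 1 ∧
        p.succAbove l = j.castSucc ∧ p.succAbove m = j.succ := by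
      have hp1 : (p : ℕ) ≠ j := fun h => hp.2 (Fin.ext h)
      have hp2 : (p : ℕ) ≠ j + 1 := fun h => hp.1 (Fin.ext h)
      obtain h | h := lt_or_gt_of_ne hp1
      · refine ⟨⟨j - 1, by omega⟩, j, ?_, ?_, ?_⟩
        · simp only; omega
        · simp only [Fin.succAbove, Fin.lt_def, Fin.ext_iff]
          grind [Fin.val_castSucc]
        · simp only [Fin.succAbove, Fin.lt_def, Fin.ext_iff]
          grind [Fin.val_castSucc]
      · have := p.is_lt
        refine ⟨⟨j, by omega⟩, ⟨j + 1, by omega⟩, rfl, ?_, ?_⟩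
        · simp only [Fin.succAbove, Fin.lt_def, Fin.ext_iff]
          grind [Fin.val_castSucc]
        · simp only [Fin.succAbove, Fin.lt_def, Fin.ext_iff]
          grind [Fin.val_castSucc]
    refine Submodule.smul_mem _ _ (Submodule.sub_mem _ ?_ ?_)
    · refine single_mem_tupleDegenerate k _ ⟨l, m, hlm, ?_⟩ _
      simp only [del, hl, hm, hj]
    · refine single_mem_tupleDegenerate k _ ⟨l, m, hlm, ?_⟩ _
      have hiff : j.castSucc < p ↔ j.succ < p := by
        have hp1 : (p : ℕ) ≠ j + 1 := fun h => hp.1 (Fin.ext h)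
        simp only [Fin.lt_def, Fin.val_castSucc, Fin.val_succ]
        omega
      simp only [actDel, hl, hm, hj, hiff]

lemma boundary_mem_degenerate (i : ℕ) :
    degenerate X k (i + 1) ≤ (degenerate X k i).comap (boundary X k i) := by
  obtain _ | n := i
  · intro c _
    exact Submodule.zero_mem (degenerate X k 0)
  · exact tupleBoundary_mem k (n + 1)

variable (X)

/-- The quandle chains of degree `i` with coefficients in `k`. -/
abbrev QChain (i : ℕ) : Type (max u v) := Chain X k i ⧸ degenerate X k i

/-- The differential induced on the quandle chains. -/
noncomputable def qBoundary (i : ℕ) : QChain X k (i + 1) →ₗ[k] QChain X k i :=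
  Submodule.mapQ _ _ (boundary X k i) (boundary_mem_degenerate k i)

lemma qBoundary_qBoundary (i : ℕ) : qBoundary X k i ∘ₗ qBoundary X k (i + 1) = 0 := by
  refine Submodule.linearMap_qext _ (LinearMap.ext fun c => ?_)
  have h := LinearMap.congr_fun (boundary_boundary (X := X) k i) c
  simp only [LinearMap.comp_apply, LinearMap.zero_apply] at h
  simp [qBoundary, h]

/-- The quandle complex `C^Q(X; k)`, the quotient of the rack complex by the degenerate chains. -/
noncomputable def quandleComplex : ChainComplex (ModuleCat.{max u v} k) ℕ :=
  ChainComplex.of (fun i => ModuleCat.of k (QChain X k i))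
    (fun i => ModuleCat.ofHom (qBoundary X k i))
    (fun i => by rw [← ModuleCat.ofHom_comp, qBoundary_qBoundary]; rfl)

end Quandle

/-! ### Functoriality -/

section Map

variable {X Y Z : Type v} (k : Type u) [CommRing k]

/-- A map, applied to every entry of a tuple. -/
def Cell.map (f : X → Y) : (i : ℕ) → Cell X i → Cell Y i
  | 0 => id
  | _ + 1 => fun x l => f (x l)

/-- The map `(x₁, …, x_i) ↦ (f x₁, …, f x_i)` on rack chains. -/
noncomputable def chainMap (f : X → Y) (i : ℕ) : Chain X k i →ₗ[k] Chain Y k i :=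
  Finsupp.lmapDomain k k (Cell.map f i)

lemma chainMap_id (i : ℕ) : chainMap k (id : X → X) i = LinearMap.id := by
  have : Cell.map (id : X → X) i = id := by cases i <;> rfl
  rw [chainMap, this, Finsupp.lmapDomain_id]

lemma chainMap_comp (f : X → Y) (g : Y → Z) (i : ℕ) :
    chainMap k (g ∘ f) i = chainMap k g i ∘ₗ chainMap k f i := by
  have : Cell.map (g ∘ f) i = Cell.map g i ∘ Cell.map f i := by cases i <;> rfl
  rw [chainMap, this, Finsupp.lmapDomain_comp]
  rfl

lemma tupleMap_tupleBoundary [Rack X] [Rack Y] (f : X →◃ Y) (n : ℕ) :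
    tupleBoundary k n ∘ₗ Finsupp.lmapDomain k k (fun (x : Fin (n + 1) → X) l => f (x l)) =
      Finsupp.lmapDomain k k (fun (x : Fin n → X) l => f (x l)) ∘ₗ tupleBoundary k n := by
  have hd : ∀ (j : Fin (n + 1)) (x : Fin (n + 1) → X),
      del j (fun l => f (x l)) = fun l => f (del j x l) := fun j x => rfl
  have ha : ∀ (j : Fin (n + 1)) (x : Fin (n + 1) → X),
      actDel j (fun l => f (x l)) = fun l => f (actDel j x l) := by
    intro j x
    funext l
    simp only [actDel, apply_ite f, ShelfHom.map_act]
  refine Finsupp.lhom_ext fun x a => ?_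
  simp only [tupleBoundary_eq, LinearMap.comp_apply, LinearMap.sum_apply, LinearMap.smul_apply,
    face_single, map_sum, map_smul, map_sub, Finsupp.lmapDomain_apply, Finsupp.mapDomain_single,
    hd, ha]

lemma chainMap_boundary [Rack X] [Rack Y] (f : X →◃ Y) (i : ℕ) :
    boundary Y k i ∘ₗ chainMap k f (i + 1) = chainMap k f i ∘ₗ boundary X k i := by
  obtain _ | n := i
  · simp [boundary]
  · exact tupleMap_tupleBoundary k f (n + 1)

lemma chainMap_degenerate (f : X → Y) (i : ℕ) :
    degenerate X k i ≤ (degenerate Y k i).comap (chainMap k f i) := by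
  obtain _ | n := i
  · exact bot_le
  refine Submodule.span_le.2 ?_
  rintro _ ⟨x, ⟨l, m, hlm, h⟩, rfl⟩
  refine Submodule.subset_span ⟨fun l => f (x l), ⟨l, m, hlm, congrArg f h⟩, ?_⟩
  exact Finsupp.mapDomain_single

/-- The map induced on quandle chains. -/
noncomputable def qChainMap (f : X → Y) (i : ℕ) : QChain X k i →ₗ[k] QChain Y k i :=
  Submodule.mapQ _ _ (chainMap k f i) (chainMap_degenerate k f i)

lemma qChainMap_id (i : ℕ) : qChainMap k (id : X → X) i = LinearMap.id := by
  refine Submodule.linearMap_qext _ (LinearMap.ext fun c => ?_)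
  simp [qChainMap, chainMap_id]

lemma qChainMap_comp (f : X → Y) (g : Y → Z) (i : ℕ) :
    qChainMap k (g ∘ f) i = qChainMap k g i ∘ₗ qChainMap k f i := by
  refine Submodule.linearMap_qext _ (LinearMap.ext fun c => ?_)
  simp [qChainMap, chainMap_comp]

lemma qChainMap_qBoundary [Quandle X] [Quandle Y] (f : X →◃ Y) (i : ℕ) :
    qBoundary Y k i ∘ₗ qChainMap k f (i + 1) = qChainMap k f i ∘ₗ qBoundary X k i := by
  refine Submodule.linearMap_qext _ (LinearMap.ext fun c => ?_)
  have h := LinearMap.congr_fun (chainMap_boundary k f i) c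
  simp only [LinearMap.comp_apply] at h
  simp [qChainMap, qBoundary, h]

/-- A homomorphism of racks induces a chain map of rack complexes. -/
noncomputable def rackComplexMap [Rack X] [Rack Y] (f : X →◃ Y) :
    rackComplex X k ⟶ rackComplex Y k :=
  ChainComplex.ofHom (fun i => ModuleCat.ofHom (chainMap k f i)) fun i => by
    simp only [rackComplex, ChainComplex.of_d]
    rw [← ModuleCat.ofHom_comp, ← ModuleCat.ofHom_comp, chainMap_boundary]

/-- A homomorphism of quandles induces a chain map of quandle complexes. -/
noncomputable def quandleComplexMap [Quandle X] [Quandle Y] (f : X →◃ Y) :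
    quandleComplex X k ⟶ quandleComplex Y k :=
  ChainComplex.ofHom (fun i => ModuleCat.ofHom (qChainMap k f i)) fun i => by
    simp only [quandleComplex, ChainComplex.of_d]
    rw [← ModuleCat.ofHom_comp, ← ModuleCat.ofHom_comp, qChainMap_qBoundary]

end Map

end RackHomology

/-! ## The quandles `c^n_Λ` -/

namespace SymQuandle

open Equiv RackHomology

/-- An integer partition, of an arbitrary natural number; `p.1` is the number `|p|` that `p`
is a partition of. -/
abbrev Par : Type := Σ m : ℕ, m.Partition

/-- A partition is primitive if it has no part equal to `1`. -/
def IsPrimitive (p : Par) : Prop := 1 ∉ p.2.parts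

/-- The number `|Λ|`, the maximum of all `|p|` for `p ∈ Λ` (and `0` if `Λ` is empty). -/
def size (Λ : Finset Par) : ℕ := Λ.sup fun p => p.1

/-- The conjugacy class `c^n_p` of the permutations of `n` letters with cycle structure
`(p, 1, …, 1)`, where fixed points count as cycles of length `1`; it is empty if `n < |p|`. -/
def permClass (p : Par) (n : ℕ) : Set (Perm (Fin n)) :=
  {σ | p.1 ≤ n ∧ σ.partition.parts = p.2.parts + Multiset.replicate (n - p.1) 1}

/-- The union `c^n_Λ` of the classes `c^n_p` for `p ∈ Λ`. -/
def permClasses (Λ : Finset Par) (n : ℕ) : Set (Perm (Fin n)) := ⋃ p ∈ Λ, permClass p n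

lemma conj_mem {Λ : Finset Par} {n : ℕ} {τ : Perm (Fin n)} (σ : Perm (Fin n))
    (h : τ ∈ permClasses Λ n) : σ * τ * σ⁻¹ ∈ permClasses Λ n := by
  simp only [permClasses, Set.mem_iUnion, permClass, Set.mem_ofPred_eq] at h ⊢
  obtain ⟨p, hp, hn, h⟩ := h
  refine ⟨p, hp, hn, ?_⟩
  rwa [← Perm.partition_eq_of_isConj.1 (isConj_iff.2 ⟨σ, rfl⟩)]

/-- The type of elements of `c^n_Λ`. -/
def ClassQuandle (Λ : Finset Par) (n : ℕ) : Type := {σ : Perm (Fin n) // σ ∈ permClasses Λ n}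

/-- `c^n_Λ` is a quandle under conjugation: `τ ▷ σ = σ ◃ τ = σ * τ * σ⁻¹`. -/
instance (Λ : Finset Par) (n : ℕ) : Quandle (ClassQuandle Λ n) where
  act σ τ := ⟨σ.1 * τ.1 * σ.1⁻¹, conj_mem σ.1 τ.2⟩
  self_distrib {x y z} := Subtype.ext (by simp [mul_assoc])
  invAct σ τ := ⟨σ.1⁻¹ * τ.1 * σ.1, by simpa using conj_mem σ.1⁻¹ τ.2⟩
  left_inv x y := Subtype.ext (by simp [mul_assoc])
  right_inv x y := Subtype.ext (by simp [mul_assoc])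
  fix {x} := Subtype.ext (by simp)

/-- For an injection `f`, the permutation `f_* σ` is `f ∘ σ ∘ f⁻¹` on the image of `f` and the
identity outside of it. -/
noncomputable def pushPerm {m n : ℕ} (f : Fin m ↪ Fin n) (σ : Perm (Fin m)) : Perm (Fin n) :=
  σ.viaEmbedding f

lemma pushPerm_apply {m n : ℕ} (f : Fin m ↪ Fin n) (σ : Perm (Fin m)) (j : Fin m) :
    pushPerm f σ (f j) = f (σ j) :=
  Perm.viaEmbedding_apply σ f j

lemma pushPerm_apply_of_notMem {m n : ℕ} (f : Fin m ↪ Fin n) (σ : Perm (Fin m)) (l : Fin n)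
    (hl : l ∉ Set.range f) : pushPerm f σ l = l :=
  Perm.viaEmbedding_apply_of_notMem σ f l hl

lemma pushPerm_mem {Λ : Finset Par} {m n : ℕ} (f : Fin m ↪ Fin n) {σ : Perm (Fin m)}
    (h : σ ∈ permClasses Λ m) : pushPerm f σ ∈ permClasses Λ n := by
  classical
  simp only [permClasses, Set.mem_iUnion, permClass, Set.mem_ofPred_eq] at h ⊢
  obtain ⟨p, hp, hm, h⟩ := h
  have hmn : m ≤ n := by simpa using Fintype.card_le_of_embedding f
  refine ⟨p, hp, hm.trans hmn, ?_⟩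
  have hc : (pushPerm f σ).cycleType = σ.cycleType := by
    simp only [pushPerm, Perm.viaEmbedding]
    convert Perm.cycleType_extendDomain (Equiv.ofInjective f.1 f.2) (g := σ)
  have hs : (pushPerm f σ).support.card = σ.support.card := by
    rw [← Perm.sum_cycleType, ← Perm.sum_cycleType, hc]
  have hle : σ.support.card ≤ m := by simpa using Finset.card_le_univ σ.support
  rw [Perm.parts_partition, Fintype.card_fin] at h ⊢
  rw [hc, hs, show n - σ.support.card = (m - σ.support.card) + (n - m) by omega,
    show n - p.1 = (m - p.1) + (n - m) by omega, Multiset.replicate_add, Multiset.replicate_add,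
    ← add_assoc, ← add_assoc, h]

/-- The map of quandles `f_* : c^m_Λ → c^n_Λ` induced by an injection `f`. -/
noncomputable def push (Λ : Finset Par) {m n : ℕ} (f : Fin m ↪ Fin n) :
    ClassQuandle Λ m →◃ ClassQuandle Λ n where
  toFun σ := ⟨pushPerm f σ.1, pushPerm_mem f σ.2⟩
  map_act' {σ τ} := Subtype.ext <| by
    change Perm.viaEmbeddingHom f (σ.1 * τ.1 * σ.1⁻¹) = Perm.viaEmbeddingHom f σ.1 *
      Perm.viaEmbeddingHom f τ.1 * (Perm.viaEmbeddingHom f σ.1)⁻¹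
    rw [map_mul, map_mul, map_inv]

lemma push_refl (Λ : Finset Par) (n : ℕ) :
    ⇑(push Λ (Function.Embedding.refl (Fin n))) = id := by
  funext σ
  exact Subtype.ext (Equiv.ext fun j => pushPerm_apply (Function.Embedding.refl (Fin n)) σ.1 j)

lemma push_trans (Λ : Finset Par) {l m n : ℕ} (f : Fin l ↪ Fin m) (g : Fin m ↪ Fin n) :
    ⇑(push Λ (f.trans g)) = ⇑(push Λ g) ∘ ⇑(push Λ f) := by
  funext σ
  refine Subtype.ext (Equiv.ext fun j => ?_)
  change pushPerm (f.trans g) σ.1 j = pushPerm g (pushPerm f σ.1) j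
  by_cases hj : j ∈ Set.range g
  · obtain ⟨j, rfl⟩ := hj
    rw [pushPerm_apply]
    by_cases hj' : j ∈ Set.range f
    · obtain ⟨j, rfl⟩ := hj'
      rw [pushPerm_apply]
      exact pushPerm_apply (f.trans g) σ.1 j
    · rw [pushPerm_apply_of_notMem f _ _ hj', pushPerm_apply_of_notMem]
      rintro ⟨a, ha⟩
      exact hj' ⟨a, g.injective ha⟩
  · rw [pushPerm_apply_of_notMem g _ _ hj, pushPerm_apply_of_notMem]
    rintro ⟨a, rfl⟩
    exact hj ⟨f a, rfl⟩

end SymQuandle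

/-! ## FI-modules -/

/-- The category FI: the object `⟨n⟩` stands for the set `[n]` with `n` elements, and the
morphisms are the injections. -/
structure FI where
  /-- The number of elements. -/
  n : ℕ

instance : Category FI where
  Hom a b := Fin a.n ↪ Fin b.n
  id a := Function.Embedding.refl (Fin a.n)
  comp f g := f.trans g

/-- An FI-module over `k` is a functor from FI to `k`-modules. -/
abbrev FIModule (k : Type u) [CommRing k] := FI ⥤ ModuleCat.{w} k

namespace FIModule

variable {k : Type u} [CommRing k]

/-- A submodule of an FI-module `V`: a family of submodules of the `V_n` that is stable under
all maps induced by injections. -/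
structure Sub (V : FIModule.{u, w} k) where
  /-- The submodule of `V_n`. -/
  carrier : ∀ a : FI, Submodule k (V.obj a)
  map_mem : ∀ {a b : FI} (f : a ⟶ b) (v : V.obj a), v ∈ carrier a → (V.map f) v ∈ carrier b

/-- `V` is finitely generated in degree `≤ d`: there is a finite subset of
`V_0 ⊕ ⋯ ⊕ V_d` that is not contained in any proper submodule of `V`. -/
def FinGenInDegree (V : FIModule.{u, w} k) (d : ℕ) : Prop :=
  ∃ S : Set (∀ a : Fin (d + 1), V.obj ⟨a⟩), S.Finite ∧
    ∀ W : Sub V, (∀ v ∈ S, ∀ a : Fin (d + 1), v a ∈ W.carrier ⟨a⟩) → ∀ b : FI, W.carrier b = ⊤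

/-- `V` is finitely generated: it is finitely generated in degree `≤ d` for some `d`. -/
def FinGen (V : FIModule.{u, w} k) : Prop := ∃ d : ℕ, FinGenInDegree V d

/-- `V` is `d`-small: it is a subquotient (a quotient `W ↠ V` of a submodule `W ↪ P`) of an
FI-module `P` that is finitely generated in degree `≤ d`. -/
def IsSmall (V : FIModule.{u, w} k) (d : ℕ) : Prop :=
  ∃ (P W : FIModule.{u, w} k) (ι : W ⟶ P) (π : W ⟶ V), FinGenInDegree P d ∧
    (∀ a : FI, Function.Injective (ι.app a)) ∧ (∀ a : FI, Function.Surjective (π.app a))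

end FIModule

/-! ## The homology of the quandles `c^n_Λ` as FI-modules -/

namespace SymQuandle

open RackHomology

variable (Λ : Finset Par) (k : Type u) [CommRing k]

/-- The complex of FI-modules `n ↦ C^R(c^n_Λ; k)`. -/
noncomputable def rackComplexFI : FI ⥤ ChainComplex (ModuleCat.{u} k) ℕ where
  obj a := rackComplex (ClassQuandle Λ a.n) k
  map f := rackComplexMap k (push Λ f)
  map_id a := by
    ext i : 1
    change ModuleCat.ofHom (chainMap k (push Λ (Function.Embedding.refl (Fin a.n))) i) = _
    rw [push_refl, chainMap_id]
    rfl
  map_comp {a b c} f g := by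
    ext i : 1
    change ModuleCat.ofHom (chainMap k (push Λ (Function.Embedding.trans f g)) i) = _
    rw [push_trans, chainMap_comp]
    rfl

/-- The complex of FI-modules `n ↦ C^Q(c^n_Λ; k)`. -/
noncomputable def quandleComplexFI : FI ⥤ ChainComplex (ModuleCat.{u} k) ℕ where
  obj a := quandleComplex (ClassQuandle Λ a.n) k
  map f := quandleComplexMap k (push Λ f)
  map_id a := by
    ext i : 1
    change ModuleCat.ofHom (qChainMap k (push Λ (Function.Embedding.refl (Fin a.n))) i) = _
    rw [push_refl, qChainMap_id]
    rfl
  map_comp {a b c} f g := by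
    ext i : 1
    change ModuleCat.ofHom (qChainMap k (push Λ (Function.Embedding.trans f g)) i) = _
    rw [push_trans, qChainMap_comp]
    rfl

/-- The FI-module `n ↦ H^R_i(c^n_Λ; k)`; an injection `f` acts by the map induced by `f_*`. -/
noncomputable def rackHomologyFI (i : ℕ) : FIModule.{u, u} k :=
  rackComplexFI Λ k ⋙ HomologicalComplex.homologyFunctor (ModuleCat.{u} k) _ i

/-- The FI-module `n ↦ H^Q_i(c^n_Λ; k)`; an injection `f` acts by the map induced by `f_*`. -/
noncomputable def quandleHomologyFI (i : ℕ) : FIModule.{u, u} k :=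
  quandleComplexFI Λ k ⋙ HomologicalComplex.homologyFunctor (ModuleCat.{u} k) _ i

end SymQuandle

/-!
The chains in degree `i` are spanned by `i`-tuples of elements of `c^n_Λ`. As the partitions are
primitive, each entry moves at most `|Λ|` letters, so a tuple moves at most `i * |Λ|` letters and is
the image of a tuple of permutations of that many letters (`SymQuandle.exists_push_tuple_eq`). Hence
the FI-module of rack chains is finitely generated in degree `≤ i * |Λ|`, and so is its quotient, the
quandle chains. Homology is a quotient of the cycles, a submodule of the chains; this is smallness.

Finite generation of the homology then follows from the Noetherian property of FI-modules over a
Noetherian ring (`FIModule.IsSmall.finGen`), proved by a Gröbner argument. A finitely generated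
FI-module is a quotient of a finite direct sum of modules `n ↦ k[Inj([d], [n])]`. Only the action of
the order embeddings is retained on this direct sum: it is strictly monotone for the lexicographic
order of the basis, and by Higman's lemma the basis is well-quasi-ordered by the relation "`y` is a
translate of `x`" (`IndexedInj.wellQuasiOrdered_rel`). The ideals of leading coefficients of a
submodule grow along this relation, so, the ring being Noetherian, finitely many of them account for
all the others, and subtracting leading terms shows that the submodule is generated in bounded degree
(`OrderedAction.exists_degree_bound`).
-/

/-! ### Monomial modules over a well-quasi-ordered basis -/

namespace OrderedAction

/-- If `r` is a well quasi-order then every element lies above an element of bounded rank. -/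
lemma exists_rank_bound {α : Type*} {r : α → α → Prop} (hr : WellQuasiOrdered r) (rk : α → ℕ) :
    ∃ N, ∀ y, ∃ x, rk x ≤ N ∧ r x y := by
  by_contra! h
  obtain ⟨f, -, hf⟩ := exists_seq_of_forall_finset_exists (fun _ : α => True)
    (fun x y => ¬ r x y) fun s _ => by
      obtain ⟨y, hy⟩ := h (s.sup rk)
      exact ⟨y, trivial, fun x hx => hy x (Finset.le_sup hx)⟩
  obtain ⟨m, n, hmn, h'⟩ := hr f
  exact hf m n hmn h'

variable {k : Type u} [CommRing k] {B : ℕ → Type} [∀ n, LinearOrder (B n)]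
  (act : ∀ m n : ℕ, (Fin m ↪o Fin n) → B m → B n)

/-- `y` is obtained from `x` by the action of some order embedding. -/
def Rel (x y : Σ n, B n) : Prop := ∃ g : Fin x.1 ↪o Fin y.1, act _ _ g x.2 = y.2

/-- The elements of `W` in the degree of `x` all of whose terms are at most `x`. -/
def truncation (W : ∀ n, Submodule k (B n →₀ k)) (x : Σ n, B n) :
    Submodule k (B x.1 →₀ k) where
  carrier := {c | c ∈ W x.1 ∧ ∀ b, x.2 < b → c b = 0}
  add_mem' h h' := ⟨add_mem h.1 h'.1, fun b hb => by simp [h.2 b hb, h'.2 b hb]⟩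
  zero_mem' := ⟨zero_mem _, fun _ _ => rfl⟩
  smul_mem' a _ h := ⟨Submodule.smul_mem _ a h.1, fun b hb => by simp [h.2 b hb]⟩

/-- The ideal of leading coefficients at the basis element `x`, that is, of the coefficients at `x`
of the elements of `W` all of whose terms are at most `x`. -/
noncomputable def leadIdeal (W : ∀ n, Submodule k (B n →₀ k)) (x : Σ n, B n) : Ideal k :=
  (truncation W x).map (Finsupp.lapply x.2)

variable {act} {W : ∀ n, Submodule k (B n →₀ k)}

lemma mapDomain_eq_zero_of_lt (hact : ∀ {m n : ℕ} (g : Fin m ↪o Fin n), StrictMono (act m n g))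
    {m n : ℕ} (g : Fin m ↪o Fin n) {x : B m} {c : B m →₀ k} (hc : ∀ b, x < b → c b = 0)
    {b : B n} (hb : act _ _ g x < b) : Finsupp.mapDomain (act _ _ g) c b = 0 := by
  by_cases h : b ∈ Set.range (act _ _ g)
  · obtain ⟨b, rfl⟩ := h
    rw [Finsupp.mapDomain_apply (hact g).injective]
    exact hc b ((hact g).lt_iff_lt.1 hb)
  · exact Finsupp.mapDomain_of_notMem_range c b h

lemma leadIdeal_mono (hact : ∀ {m n : ℕ} (g : Fin m ↪o Fin n), StrictMono (act m n g))
    (hW : ∀ {m n : ℕ} (g : Fin m ↪o Fin n), ∀ c ∈ W m, Finsupp.mapDomain (act _ _ g) c ∈ W n)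
    {x y : Σ n, B n} (h : Rel act x y) : leadIdeal W x ≤ leadIdeal W y := by
  obtain ⟨m, x⟩ := x
  obtain ⟨n, y⟩ := y
  obtain ⟨g, rfl⟩ : ∃ g, act m n g x = y := h
  rintro _ ⟨c, ⟨hc, hcx⟩, rfl⟩
  exact ⟨Finsupp.mapDomain (act _ _ g) c,
    ⟨hW g c hc, fun b hb => mapDomain_eq_zero_of_lt hact g hcx hb⟩,
    Finsupp.mapDomain_apply (hact g).injective c x⟩

/-- Gröbner argument: if `Rel` is a well quasi-order and `k` is Noetherian, a family of submodules
of the free modules on the `B n` that is stable under the action is determined in bounded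
degrees. -/
theorem exists_degree_bound [IsNoetherianRing k] [∀ n, Finite (B n)]
    (hact : ∀ {m n : ℕ} (g : Fin m ↪o Fin n), StrictMono (act m n g))
    [IsPreorder _ (Rel act)] (hwqo : WellQuasiOrdered (Rel act))
    (hW : ∀ {m n : ℕ} (g : Fin m ↪o Fin n), ∀ c ∈ W m, Finsupp.mapDomain (act _ _ g) c ∈ W n) :
    ∃ N, ∀ W' : ∀ n, Submodule k (B n →₀ k),
      (∀ {m n : ℕ} (g : Fin m ↪o Fin n), ∀ c ∈ W' m, Finsupp.mapDomain (act _ _ g) c ∈ W' n) →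
      (∀ n ≤ N, W n ≤ W' n) → ∀ n, W n ≤ W' n := by
  -- Leading ideals grow along `Rel`, so requiring them to be equal keeps a well quasi-order.
  have hr : WellQuasiOrdered fun x y => Rel act x y ∧ leadIdeal W x = leadIdeal W y := by
    intro f
    obtain ⟨g, hg⟩ := hwqo.exists_monotone_subseq f
    obtain ⟨n, hn⟩ := monotone_stabilizes_iff_noetherian.2 ‹IsNoetherianRing k›
      ⟨fun j => leadIdeal W (f (g j)), fun a b h => leadIdeal_mono hact hW (hg a b h)⟩
    exact ⟨g n, g (n + 1), g.strictMono n.lt_succ_self, hg _ _ n.le_succ, hn _ n.le_succ⟩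
  obtain ⟨N, hN⟩ := exists_rank_bound hr Sigma.fst
  refine ⟨N, fun W' hW' hle n => ?_⟩
  have key : ∀ b : B n, ∀ c ∈ W n, (∀ b', b < b' → c b' = 0) → c ∈ W' n := by
    intro b
    induction b using WellFoundedLT.induction with
    | _ b ih =>
    intro c hc hcb
    obtain ⟨⟨m, x⟩, hm, hg, hI⟩ := hN ⟨n, b⟩
    obtain ⟨g, rfl⟩ : ∃ g, act m n g x = b := hg
    have hcI : c (act _ _ g x) ∈ leadIdeal W ⟨n, act _ _ g x⟩ := ⟨c, ⟨hc, hcb⟩, rfl⟩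
    rw [← hI] at hcI
    obtain ⟨e, ⟨he, hex⟩, hec⟩ := hcI
    dsimp only at he hex hec
    have he' := hW' g e (hle m hm he)
    -- subtract an element of `W'` with the same leading term
    suffices h : c - Finsupp.mapDomain (act _ _ g) e ∈ W' n by simpa using add_mem h he'
    by_cases h0 : c - Finsupp.mapDomain (act _ _ g) e = 0
    · rw [h0]
      exact zero_mem _
    have hne : (c - Finsupp.mapDomain (act _ _ g) e).support.Nonempty :=
      Finsupp.support_nonempty_iff.2 h0
    have hmax := Finset.max'_mem _ hne
    refine ih (Finset.max' _ hne) (lt_of_not_ge fun hge => ?_) _ (sub_mem hc (hW g e he))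
      fun b' hb' => ?_
    · rw [Finsupp.mem_support_iff, Finsupp.sub_apply] at hmax
      refine hmax ?_
      rcases hge.eq_or_lt with h | h
      · rw [← h, Finsupp.mapDomain_apply (hact g).injective, ← hec, Finsupp.lapply_apply, sub_self]
      · rw [hcb _ h, mapDomain_eq_zero_of_lt hact g hex h, sub_zero]
    · by_contra h
      exact hb'.not_ge (Finset.le_max' _ _ (Finsupp.mem_support_iff.2 h))
  intro c hc
  by_cases h0 : c = 0
  · rw [h0]
    exact zero_mem _
  have hne : c.support.Nonempty := Finsupp.support_nonempty_iff.2 h0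
  refine key (Finset.max' _ hne) c hc fun b' hb' => ?_
  by_contra h
  exact hb'.not_ge (Finset.le_max' _ _ (Finsupp.mem_support_iff.2 h))

end OrderedAction

/-! ### Well-quasi-ordering of injections under order embeddings -/

/-- An index `s` together with an injection from a set with `d s` elements to a set with `n`
elements. -/
structure IndexedInj {r : ℕ} (d : Fin r → ℕ) (n : ℕ) where
  /-- The index. -/
  idx : Fin r
  /-- The injection. -/
  emb : Fin (d idx) ↪ Fin n

namespace IndexedInj

variable {r : ℕ} {d : Fin r → ℕ}

instance (n : ℕ) : Finite (IndexedInj d n) :=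
  Finite.of_injective (fun x => (⟨x.1, x.2⟩ : Σ s : Fin r, Fin (d s) ↪ Fin n)) <| by
    rintro ⟨s, f⟩ ⟨t, g⟩ h
    cases h
    rfl

/-- The lexicographic comparison key of an injection, given by its index and its values. -/
def key {n : ℕ} (x : IndexedInj d n) : Σₗ s : Fin r, Lex (Fin (d s) → Fin n) :=
  toLex ⟨x.idx, toLex x.emb⟩

lemma key_injective {n : ℕ} : Function.Injective (key (d := d) (n := n)) := by
  rintro ⟨s, f⟩ ⟨t, g⟩ h
  obtain ⟨h1, h2⟩ := Sigma.mk.inj_iff.1 (toLex.injective h)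
  dsimp only at h1
  subst h1
  have h3 : f = g := DFunLike.coe_injective (toLex.injective (eq_of_heq h2))
  rw [h3]

noncomputable instance (n : ℕ) : LinearOrder (IndexedInj d n) := LinearOrder.lift' key key_injective

lemma lt_iff_key {n : ℕ} {x y : IndexedInj d n} : x < y ↔ key x < key y := Iff.rfl

/-- Composition with an order embedding. -/
def act (m n : ℕ) (g : Fin m ↪o Fin n) (x : IndexedInj d m) : IndexedInj d n :=
  ⟨x.idx, x.emb.trans g.toEmbedding⟩

lemma act_strictMono {m n : ℕ} (g : Fin m ↪o Fin n) : StrictMono (act (d := d) m n g) := by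
  rintro ⟨s, f⟩ ⟨t, f'⟩ h
  rw [lt_iff_key] at h ⊢
  rcases Sigma.Lex.lt_def.1 h with h | ⟨h, h'⟩
  · exact Sigma.Lex.lt_def.2 (Or.inl h)
  · change s = t at h
    subst h
    refine Sigma.Lex.lt_def.2 (Or.inr ⟨rfl, ?_⟩)
    obtain ⟨a, ha, ha'⟩ := h'
    exact ⟨a, fun b hb => congrArg g (ha b hb), g.strictMono ha'⟩

instance : IsPreorder (Σ n, IndexedInj d n) (OrderedAction.Rel act) where
  refl x := ⟨RelEmbedding.refl _, rfl⟩
  trans := by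
    rintro ⟨a, x⟩ ⟨b, y⟩ ⟨c, z⟩ hxy hyz
    obtain ⟨g, rfl⟩ : ∃ g, act a b g x = y := hxy
    obtain ⟨h, rfl⟩ : ∃ h, act b c h _ = z := hyz
    exact ⟨g.trans h, rfl⟩

open Classical in
/-- The word of length `n` that has the letter `a` at the place `f a`, and a blank at the
places that are not values of the injection `f`. -/
noncomputable def word (x : Σ n, IndexedInj d n) : List (Option (Σ s : Fin r, Fin (d s))) :=
  List.ofFn fun j : Fin x.1 =>
    if h : ∃ a, x.2.emb a = j then some ⟨x.2.idx, h.choose⟩ else none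

lemma length_word (x : Σ n, IndexedInj d n) : (word x).length = x.1 := List.length_ofFn

open Classical in
lemma get_word (x : Σ n, IndexedInj d n) (j : Fin (word x).length) :
    (word x).get j = if h : ∃ a, x.2.emb a = Fin.cast (length_word x) j then
      some ⟨x.2.idx, h.choose⟩ else none :=
  List.get_ofFn _ _

lemma get_word_eq_some {x : Σ n, IndexedInj d n} {j : Fin (word x).length} {a : Fin (d x.2.idx)} :
    (word x).get j = some ⟨x.2.idx, a⟩ ↔ x.2.emb a = Fin.cast (length_word x) j := by
  rw [get_word]
  constructor
  · intro h
    split_ifs at h with h'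
    have h2 := eq_of_heq (Sigma.mk.inj_iff.1 (Option.some.inj h)).2
    rw [← h2]
    exact h'.choose_spec
  · intro h
    have h' : ∃ a, x.2.emb a = Fin.cast (length_word x) j := ⟨a, h⟩
    rw [dif_pos h', x.2.emb.injective (h'.choose_spec.trans h.symm)]

/-- Injections are well-quasi-ordered under composition with order embeddings: this is Higman's
lemma for the words over a finite alphabet that encode them. -/
theorem wellQuasiOrdered_rel : WellQuasiOrdered (OrderedAction.Rel (act (d := d))) := by
  have hw : WellQuasiOrdered
      (List.SublistForall₂ (α := Option (Σ s : Fin r, Fin (d s))) (· = ·)) := by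
    have h := Set.PartiallyWellOrderedOn.partiallyWellOrderedOn_sublistForall₂ (· = ·)
      (Set.finite_univ (α := Option (Σ s : Fin r, Fin (d s)))).partiallyWellOrderedOn
    simpa [Set.partiallyWellOrderedOn_univ_iff] using h
  -- The index is recorded separately, as a word with blanks only does not determine it.
  intro F
  obtain ⟨m, n, hmn, hidx, hword⟩ := (Finite.wellQuasiOrdered (α := Fin r) (· = ·)).prod hw
    fun j => ((F j).2.idx, word (F j))
  refine ⟨m, n, hmn, ?_⟩
  dsimp only at hidx hword
  generalize F m = x at hidx hword
  generalize F n = y at hidx hword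
  rw [List.sublistForall₂_iff] at hword
  simp only [List.forall₂_eq_eq_eq, exists_eq_left'] at hword
  obtain ⟨g, hg⟩ := List.sublist_iff_exists_fin_orderEmbedding_get_eq.1 hword
  obtain ⟨a, s, f⟩ := x
  obtain ⟨b, t, f'⟩ := y
  change s = t at hidx
  subst hidx
  let g' : Fin a ↪o Fin b := (Fin.castOrderIso (length_word ⟨a, s, f⟩).symm).toOrderEmbedding.trans
    (g.trans (Fin.castOrderIso (length_word ⟨b, s, f'⟩)).toOrderEmbedding)
  refine ⟨g', ?_⟩
  have hf : f.trans g'.toEmbedding = f' := by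
    ext1 c
    have h := hg (Fin.cast (length_word ⟨a, s, f⟩).symm (f c))
    have h1 := (get_word_eq_some (x := ⟨a, s, f⟩) (a := c)
      (j := Fin.cast (length_word ⟨a, s, f⟩).symm (f c))).2 rfl
    rw [h1] at h
    exact ((get_word_eq_some (x := ⟨b, s, f'⟩) (a := c)).1 h.symm).symm
  change IndexedInj.mk s (f.trans g'.toEmbedding) = ⟨s, f'⟩
  rw [hf]

end IndexedInj

/-! ### The Noetherian property of FI-modules -/

namespace FIModule

variable {k : Type u} [CommRing k] {P V : FIModule.{u, w} k} {D : ℕ}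

lemma map_comp_apply (V : FIModule.{u, w} k) {a b c : FI} (f : a ⟶ b) (g : b ⟶ c) (x : V.obj a) :
    (V.map (f ≫ g)) x = (V.map g) ((V.map f) x) := by
  rw [V.map_comp]
  rfl

lemma map_id_apply (V : FIModule.{u, w} k) {a : FI} (x : V.obj a) : (V.map (𝟙 a)) x = x := by
  rw [V.map_id]
  rfl

lemma naturality_apply (π : P ⟶ V) {a b : FI} (f : a ⟶ b) (x : P.obj a) :
    (π.app b) ((P.map f) x) = (V.map f) ((π.app a) x) :=
  ConcreteCategory.congr_hom (π.naturality f) x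

namespace Sub

/-- The inverse image of a submodule of an FI-module. -/
def comap (π : P ⟶ V) (U : Sub V) : Sub P where
  carrier a := (U.carrier a).comap (π.app a).hom
  map_mem f x hx := by
    change (π.app _) ((P.map f) x) ∈ U.carrier _
    rw [naturality_apply]
    exact U.map_mem f _ hx

/-- The image of a submodule of an FI-module. -/
def map (π : P ⟶ V) (U : Sub P) : Sub V where
  carrier a := (U.carrier a).map (π.app a).hom
  map_mem := by
    rintro a b f _ ⟨x, hx, rfl⟩
    exact ⟨(P.map f) x, U.map_mem f x hx, naturality_apply π f x⟩

end Sub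

/-- A finite set of generators, listed with their degrees. -/
lemma FinGenInDegree.exists_generators (h : FinGenInDegree P D) :
    ∃ (r : ℕ) (d : Fin r → ℕ) (v : ∀ s, P.obj ⟨d s⟩), ∀ n : ℕ,
      Submodule.span k (Set.range fun x : IndexedInj d n =>
        (P.map (X := ⟨d x.idx⟩) (Y := ⟨n⟩) x.emb) (v x.idx)) = ⊤ := by
  obtain ⟨S, hS, h⟩ := h
  have := hS.to_subtype
  obtain ⟨r, ⟨e⟩⟩ := Finite.exists_equiv_fin (S × Fin (D + 1))
  refine ⟨r, fun s => (e.symm s).2, fun s => (e.symm s).1.1 (e.symm s).2, fun n => ?_⟩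
  let W : Sub P :=
    { carrier := fun a => Submodule.span k (Set.range
        fun x : IndexedInj (fun s => ((e.symm s).2 : ℕ)) a.n =>
          (P.map (X := ⟨(e.symm x.idx).2⟩) (Y := a) x.emb) ((e.symm x.idx).1.1 (e.symm x.idx).2))
      map_mem := fun {a b} f x hx => by
        refine Submodule.span_induction (p := fun x _ => (P.map f) x ∈ _) ?_ ?_ ?_ ?_ hx
        · rintro _ ⟨x, rfl⟩
          refine Submodule.subset_span ⟨⟨x.idx, x.emb.trans f⟩, ?_⟩
          exact map_comp_apply P (a := ⟨(e.symm x.idx).2⟩) (b := a) x.emb f _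
        · rw [map_zero]
          exact zero_mem _
        · intro x y _ _ hx hy
          rw [map_add]
          exact add_mem hx hy
        · intro c x _ hx
          rw [map_smul]
          exact Submodule.smul_mem _ c hx }
  refine h W (fun v hv a => Submodule.subset_span ?_) ⟨n⟩
  have key : ∀ t : S × Fin (D + 1), e.symm (e t) = t := e.symm_apply_apply
  have : ∀ (t t' : S × Fin (D + 1)), t' = t → ∃ f : Fin t'.2 ↪ Fin t.2,
      (P.map (X := ⟨t'.2⟩) (Y := ⟨t.2⟩) f) (t'.1.1 t'.2) = t.1.1 t.2 := by
    rintro _ t rfl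
    exact ⟨_, map_id_apply P (a := ⟨t.2⟩) _⟩
  obtain ⟨f, hf⟩ := this _ _ (key (⟨v, hv⟩, a))
  exact ⟨⟨e (⟨v, hv⟩, a), f⟩, hf⟩

lemma FinGenInDegree.moduleFinite (h : FinGenInDegree P D) (a : FI) :
    Module.Finite k (P.obj a) := by
  obtain ⟨r, d, v, hv⟩ := h.exists_generators
  exact ⟨Submodule.fg_def.2 ⟨_, Set.finite_range _, hv a.n⟩⟩

/-- Over a Noetherian ring a submodule of a finitely generated FI-module is determined in bounded
degrees: it is pulled back to the free modules on the injections that index the translates of the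
generators, where the Gröbner argument applies. -/
theorem FinGenInDegree.exists_degree_bound [IsNoetherianRing k] (h : FinGenInDegree P D)
    (W : Sub P) : ∃ N, ∀ W' : Sub P, (∀ n ≤ N, W.carrier ⟨n⟩ ≤ W'.carrier ⟨n⟩) →
      ∀ a, W.carrier a ≤ W'.carrier a := by
  obtain ⟨r, d, v, hv⟩ := h.exists_generators
  let φ (n : ℕ) : (IndexedInj d n →₀ k) →ₗ[k] P.obj ⟨n⟩ :=
    Finsupp.linearCombination k fun x : IndexedInj d n =>
      (P.map (X := ⟨d x.idx⟩) (Y := ⟨n⟩) x.emb) (v x.idx)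
  have hφ (n : ℕ) : Function.Surjective (φ n) := by
    rw [← LinearMap.range_eq_top, Finsupp.range_linearCombination]
    exact hv n
  have hact {m n : ℕ} (g : Fin m ↪o Fin n) (c : IndexedInj d m →₀ k) :
      φ n (Finsupp.mapDomain (IndexedInj.act m n g) c) =
        (P.map (X := ⟨m⟩) (Y := ⟨n⟩) g.toEmbedding) (φ m c) := by
    induction c using Finsupp.induction_linear with
    | zero => simp only [Finsupp.mapDomain_zero, map_zero]
    | add c c' hc hc' => simp only [Finsupp.mapDomain_add, map_add, hc, hc']
    | single x b =>
      simp only [Finsupp.mapDomain_single, φ, Finsupp.linearCombination_single, map_smul]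
      congr 1
      exact map_comp_apply P (a := ⟨d x.idx⟩) (b := ⟨m⟩) (c := ⟨n⟩) x.emb g.toEmbedding _
  have hstable (U : Sub P) {m n : ℕ} (g : Fin m ↪o Fin n) :
      ∀ c ∈ (U.carrier ⟨m⟩).comap (φ m),
        Finsupp.mapDomain (IndexedInj.act m n g) c ∈ (U.carrier ⟨n⟩).comap (φ n) := by
    intro c hc
    rw [Submodule.mem_comap, hact]
    exact U.map_mem (a := ⟨m⟩) (b := ⟨n⟩) g.toEmbedding _ hc
  obtain ⟨N, hN⟩ := OrderedAction.exists_degree_bound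
    (W := fun n => (W.carrier ⟨n⟩).comap (φ n)) (act := IndexedInj.act)
    IndexedInj.act_strictMono IndexedInj.wellQuasiOrdered_rel (hstable W)
  refine ⟨N, fun W' hle a x hx => ?_⟩
  obtain ⟨c, rfl⟩ := hφ a.n x
  exact hN (fun n => (W'.carrier ⟨n⟩).comap (φ n)) (hstable W')
    (fun n hn => Submodule.comap_mono (hle n hn)) a.n hx

/-- An FI-module that is generated by its part of degree `≤ D`, and finitely generated in each
degree `≤ D`, is finitely generated in degree `≤ D`. -/
lemma finGenInDegree_of_forall (hfin : ∀ n ≤ D, Module.Finite k (V.obj ⟨n⟩))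
    (hgen : ∀ U : Sub V, (∀ n ≤ D, U.carrier ⟨n⟩ = ⊤) → ∀ b, U.carrier b = ⊤) :
    FinGenInDegree V D := by
  classical
  choose T hT hspan using fun a : Fin (D + 1) =>
    Submodule.fg_def.1 (hfin a (Nat.le_of_lt_succ a.2)).fg_top
  refine ⟨⋃ a, (fun t => Pi.single (M := fun a : Fin (D + 1) => V.obj ⟨a⟩) a t) '' T a,
    Set.finite_iUnion fun a => (hT a).image _, fun U hU => hgen U fun n hn => ?_⟩
  obtain ⟨a, rfl⟩ : ∃ a : Fin (D + 1), (a : ℕ) = n := ⟨⟨n, Nat.lt_succ_of_le hn⟩, rfl⟩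
  rw [eq_top_iff, ← hspan a, Submodule.span_le]
  intro t ht
  have h := hU _ (Set.mem_iUnion.2 ⟨a, t, ht, rfl⟩) a
  dsimp only at h
  rwa [Pi.single_eq_same] at h

lemma FinGenInDegree.of_surjective (h : FinGenInDegree P D) (π : P ⟶ V)
    (hπ : ∀ a, Function.Surjective (π.app a)) : FinGenInDegree V D := by
  obtain ⟨S, hS, h⟩ := h
  refine ⟨(fun s a => (π.app ⟨a⟩) (s a)) '' S, hS.image _, fun U hU b => ?_⟩
  have hb := h (U.comap π) (fun s hs a => hU _ ⟨s, hs, rfl⟩ a) b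
  refine eq_top_iff.2 fun y _ => ?_
  obtain ⟨x, rfl⟩ := hπ b y
  exact (Submodule.eq_top_iff'.1 hb x : x ∈ (U.carrier b).comap (π.app b).hom)

/-- Over a Noetherian ring a subquotient of a finitely generated FI-module is finitely
generated. -/
theorem IsSmall.finGen [IsNoetherianRing k] (h : IsSmall V D) : FinGen V := by
  obtain ⟨P, W, ι, π, hP, hι, hπ⟩ := h
  let T : Sub W := ⟨fun _ => ⊤, fun _ _ _ => Submodule.mem_top⟩
  obtain ⟨N, hN⟩ := hP.exists_degree_bound (T.map ι)
  refine ⟨N, finGenInDegree_of_forall (fun n _ => ?_) fun U hU b => eq_top_iff.2 fun y _ => ?_⟩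
  · have := hP.moduleFinite ⟨n⟩
    have : Module.Finite k (W.obj ⟨n⟩) := Module.Finite.of_injective (ι.app ⟨n⟩).hom (hι _)
    exact Module.Finite.of_surjective (π.app ⟨n⟩).hom (hπ _)
  · obtain ⟨x, rfl⟩ := hπ b y
    obtain ⟨x', hx', he⟩ := hN ((U.comap π).map ι) (fun n hn => by
      rintro _ ⟨x, -, rfl⟩
      refine ⟨x, ?_, rfl⟩
      change (π.app ⟨n⟩) x ∈ U.carrier ⟨n⟩
      rw [hU n hn]
      exact Submodule.mem_top) b ⟨x, Submodule.mem_top, rfl⟩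
    rw [← hι b he]
    exact hx'

end FIModule

/-! ### The chains are generated in bounded degree -/

namespace SymQuandle

open Equiv RackHomology

variable {Λ : Finset Par}

instance (n : ℕ) : Finite (ClassQuandle Λ n) := Subtype.finite

instance (n : ℕ) : ∀ i, Finite (Cell (ClassQuandle Λ n) i)
  | 0 => inferInstanceAs (Finite PEmpty)
  | i + 1 => inferInstanceAs (Finite (Fin (i + 1) → ClassQuandle Λ n))

lemma card_support_eq {p : Par} (hp : IsPrimitive p) {n : ℕ} {σ : Perm (Fin n)}
    (h : σ ∈ permClass p n) : σ.support.card = p.1 := by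
  obtain ⟨hn, h⟩ := h
  have hc := congrArg (Multiset.count 1) h
  rw [Perm.parts_partition, Multiset.count_add, Multiset.count_add, Fintype.card_fin,
    Multiset.count_replicate_self, Multiset.count_replicate_self,
    Multiset.count_eq_zero_of_notMem hp,
    Multiset.count_eq_zero_of_notMem fun h => (Perm.one_lt_of_mem_cycleType h).ne rfl] at hc
  have : σ.support.card ≤ n := by simpa using Finset.card_le_univ σ.support
  omega

lemma cycleType_eq {p : Par} (hp : IsPrimitive p) {n : ℕ} {σ : Perm (Fin n)}
    (h : σ ∈ permClass p n) : σ.cycleType = p.2.parts := by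
  have hs := card_support_eq hp h
  have h' := h.2
  rw [Perm.parts_partition, Fintype.card_fin, hs] at h'
  exact add_right_cancel h'

lemma mem_permClass_of_cycleType {p : Par} {n : ℕ} {σ : Perm (Fin n)}
    (h : σ.cycleType = p.2.parts) : σ ∈ permClass p n := by
  have hs : σ.support.card = p.1 := by rw [← Perm.sum_cycleType, h, p.2.parts_sum]
  refine ⟨?_, ?_⟩
  · simpa [hs] using Finset.card_le_univ σ.support
  · rw [Perm.parts_partition, h, hs, Fintype.card_fin]

lemma cycleType_pushPerm {m n : ℕ} (f : Fin m ↪ Fin n) (σ : Perm (Fin m)) :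
    (pushPerm f σ).cycleType = σ.cycleType := by
  simp only [pushPerm, Perm.viaEmbedding]
  convert Perm.cycleType_extendDomain (Equiv.ofInjective f.1 f.2) (g := σ)

/-- A permutation that is supported in the image of an injection `f` comes from the source
of `f`. -/
lemma exists_pushPerm_eq {m n : ℕ} (f : Fin m ↪ Fin n) (σ : Perm (Fin n))
    (h : ∀ j ∈ σ.support, j ∈ Set.range f) : ∃ τ, pushPerm f τ = σ := by
  have hf : ∀ j, j ∉ Set.range f → σ j = j := fun j hj => by
    by_contra h'
    exact hj (h j (Perm.mem_support.2 h'))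
  have hσ : ∀ j, σ j ∈ Set.range f ↔ j ∈ Set.range f := by
    intro j
    by_cases hj : j ∈ Set.range f
    · refine iff_of_true ?_ hj
      by_contra h'
      have he : σ j = j := σ.injective (hf _ h')
      exact h' (he.symm ▸ hj)
    · rw [hf j hj]
  refine ⟨(Equiv.ofInjective f f.injective).symm.permCongr (σ.subtypePerm hσ), Equiv.ext fun j => ?_⟩
  by_cases hj : j ∈ Set.range f
  · obtain ⟨j, rfl⟩ := hj
    rw [pushPerm_apply]
    simp [Equiv.permCongr_apply, Equiv.apply_ofInjective_symm f.injective]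
  · rw [pushPerm_apply_of_notMem f _ _ hj, hf j hj]

lemma exists_push_eq (hΛ : ∀ p ∈ Λ, IsPrimitive p) {m n : ℕ} (f : Fin m ↪ Fin n)
    (σ : ClassQuandle Λ n) (h : ∀ j ∈ σ.1.support, j ∈ Set.range f) :
    ∃ τ : ClassQuandle Λ m, push Λ f τ = σ := by
  obtain ⟨σ, hσ⟩ := σ
  obtain ⟨τ, rfl⟩ := exists_pushPerm_eq f σ h
  refine ⟨⟨τ, ?_⟩, rfl⟩
  simp only [permClasses, Set.mem_iUnion] at hσ ⊢
  obtain ⟨p, hp, hσ⟩ := hσ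
  refine ⟨p, hp, mem_permClass_of_cycleType ?_⟩
  rw [← cycleType_pushPerm f, cycleType_eq (hΛ p hp) hσ]

lemma card_support_le (hΛ : ∀ p ∈ Λ, IsPrimitive p) {n : ℕ} (σ : ClassQuandle Λ n) :
    σ.1.support.card ≤ size Λ := by
  obtain ⟨σ, hσ⟩ := σ
  simp only [permClasses, Set.mem_iUnion] at hσ
  obtain ⟨p, hp, hσ⟩ := hσ
  rw [card_support_eq (hΛ p hp) hσ]
  exact Finset.le_sup (f := fun p : Par => p.1) hp

/-- An `i`-tuple of elements of `c^n_Λ` moves at most `i * |Λ|` letters in total, so it comes from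
a tuple of permutations of this number of letters. -/
lemma exists_push_tuple_eq (hΛ : ∀ p ∈ Λ, IsPrimitive p) {i n : ℕ} (hn : i * size Λ ≤ n)
    (x : Fin i → ClassQuandle Λ n) :
    ∃ (f : Fin (i * size Λ) ↪ Fin n) (y : Fin i → ClassQuandle Λ (i * size Λ)),
      (fun l => push Λ f (y l)) = x := by
  have hcard : (Finset.univ.biUnion fun l => (x l).1.support).card ≤ i * size Λ := by
    simpa using Finset.card_biUnion_le_card_mul Finset.univ (fun l => (x l).1.support) (size Λ)
      fun l _ => card_support_le hΛ (x l)
  obtain ⟨t, hsub, -, ht⟩ := Finset.exists_subsuperset_card_eq (Finset.subset_univ _) hcard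
    (by simpa using hn)
  have hrange : Set.range (t.orderEmbOfFin ht) = t := Finset.range_orderEmbOfFin t ht
  choose y hy using fun l => exists_push_eq hΛ (t.orderEmbOfFin ht).toEmbedding (x l)
    fun j hj => by
      change j ∈ Set.range (t.orderEmbOfFin ht)
      rw [hrange]
      exact hsub (Finset.mem_biUnion.2 ⟨l, Finset.mem_univ l, hj⟩)
  exact ⟨_, y, funext hy⟩

variable (Λ) (k : Type u) [CommRing k]

/-- The FI-module `n ↦ C^R_i(c^n_Λ; k)`. -/
noncomputable abbrev rackChainsFI (i : ℕ) : FIModule.{u, u} k :=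
  rackComplexFI Λ k ⋙ HomologicalComplex.eval (ModuleCat.{u} k) _ i

/-- The FI-module `n ↦ C^Q_i(c^n_Λ; k)`. -/
noncomputable abbrev quandleChainsFI (i : ℕ) : FIModule.{u, u} k :=
  quandleComplexFI Λ k ⋙ HomologicalComplex.eval (ModuleCat.{u} k) _ i

variable {Λ}

theorem finGenInDegree_rackChainsFI (hΛ : ∀ p ∈ Λ, IsPrimitive p) (i : ℕ) :
    FIModule.FinGenInDegree (rackChainsFI Λ k i) (i * size Λ) := by
  refine FIModule.finGenInDegree_of_forall (fun n _ => ?_) fun U hU b => ?_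
  · exact inferInstanceAs (Module.Finite k (Cell (ClassQuandle Λ n) i →₀ k))
  by_cases hb : b.n ≤ i * size Λ
  · exact hU _ hb
  refine Submodule.eq_top_iff'.2 fun c => ?_
  change Cell (ClassQuandle Λ b.n) i →₀ k at c
  change c ∈ (U.carrier b : Submodule k (Cell (ClassQuandle Λ b.n) i →₀ k))
  induction c using Finsupp.induction_linear with
  | zero => exact zero_mem _
  | add c c' hc hc' => exact add_mem hc hc'
  | single x a =>
    obtain _ | i := i
    · exact x.elim
    obtain ⟨f, y, rfl⟩ := exists_push_tuple_eq hΛ (le_of_not_ge hb) x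
    have hy := U.map_mem (a := ⟨(i + 1) * size Λ⟩) (b := b) f (Finsupp.single y a : Chain _ k (i + 1))
      (by rw [hU _ le_rfl]; exact Submodule.mem_top)
    have e : chainMap k (push Λ f) (i + 1) (Finsupp.single y a) =
        Finsupp.single (fun l => push Λ f (y l)) a := Finsupp.mapDomain_single
    change chainMap k (push Λ f) (i + 1) (Finsupp.single y a) ∈
      (U.carrier b : Submodule k (Cell (ClassQuandle Λ b.n) (i + 1) →₀ k)) at hy
    exact e ▸ hy

theorem finGenInDegree_quandleChainsFI (hΛ : ∀ p ∈ Λ, IsPrimitive p) (i : ℕ) :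
    FIModule.FinGenInDegree (quandleChainsFI Λ k i) (i * size Λ) := by
  let π : rackChainsFI Λ k i ⟶ quandleChainsFI Λ k i :=
    { app := fun a => ModuleCat.ofHom (degenerate (ClassQuandle Λ a.n) k i).mkQ
      naturality := fun _ _ _ => rfl }
  exact (finGenInDegree_rackChainsFI k hΛ i).of_surjective π
    fun a => Submodule.mkQ_surjective (degenerate (ClassQuandle Λ a.n) k i)

/-! ### Homology -/

variable {k}

/-- The homology of a complex of FI-modules is a subquotient of its chains, by way of the
cycles. -/
theorem isSmall_homology (C : FI ⥤ ChainComplex (ModuleCat.{u} k) ℕ) (i D : ℕ)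
    (h : FIModule.FinGenInDegree (C ⋙ HomologicalComplex.eval (ModuleCat.{u} k) _ i) D) :
    FIModule.IsSmall (C ⋙ HomologicalComplex.homologyFunctor (ModuleCat.{u} k) _ i) D :=
  ⟨C ⋙ HomologicalComplex.eval (ModuleCat.{u} k) _ i,
    C ⋙ HomologicalComplex.cyclesFunctor (ModuleCat.{u} k) _ i,
    { app := fun a => (C.obj a).iCycles i
      naturality := fun _ _ f => HomologicalComplex.cyclesMap_i (C.map f) i },
    { app := fun a => (C.obj a).homologyπ i
      naturality := fun _ _ f => (HomologicalComplex.homologyπ_naturality (C.map f) i).symm },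
    h, fun a => (ModuleCat.mono_iff_injective ((C.obj a).iCycles i)).1 inferInstance,
    fun a => (ModuleCat.epi_iff_surjective ((C.obj a).homologyπ i)).1 inferInstance⟩

end SymQuandle

theorem theorem3p1 (Λ : Finset SymQuandle.Par) (hΛ : ∀ p ∈ Λ, SymQuandle.IsPrimitive p)
    (i : ℕ) (k : Type u) [CommRing k] [IsNoetherianRing k] :
    (FIModule.FinGen (SymQuandle.rackHomologyFI Λ k i) ∧
      FIModule.FinGen (SymQuandle.quandleHomologyFI Λ k i)) ∧
    (FIModule.IsSmall (SymQuandle.rackHomologyFI Λ k i) (i * SymQuandle.size Λ) ∧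
      FIModule.IsSmall (SymQuandle.quandleHomologyFI Λ k i) (i * SymQuandle.size Λ)) := by
  have hR := SymQuandle.isSmall_homology (SymQuandle.rackComplexFI Λ k) i _
    (SymQuandle.finGenInDegree_rackChainsFI k hΛ i)
  have hQ := SymQuandle.isSmall_homology (SymQuandle.quandleComplexFI Λ k) i _
    (SymQuandle.finGenInDegree_quandleChainsFI k hΛ i)
  exact ⟨⟨hR.finGen, hQ.finGen⟩, hR, hQ⟩
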